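/- Throughout, a monoid is a commutative cancellative semigroup with unit element (except that in the definition of weak transfer homomorphisms commutativity is not needed), $\mathbb N$ is the set of positive integers and $\mathbb N_0=\mathbb N\cup\{0\}$. Let $H$ be a monoid with group of units $H^\times$, and let $\mathfrak m=H\setminus H^\times$. An atom is a non-unit that is not a product of two non-units; $H$ is atomic if every non-unit is a finite product of atoms. For $a\in\mathfrak m$ let $\mathsf L(a)\subset\mathbb N$ be the set of all $k\in\mathbb N$ such that $a$ is a product of $k$ atoms; for $a\in H^\times$ put $\mathsf L(a)=\{0\}$. Let $\mathcal L(H)=\{\mathsf L(a)\mid a\in H\}$, and call $H$ half-factorial if $|L|=1$ for all $L\in\mathcal L(H)$. For $L\subset\mathbb N$ let $\rho(L)=\sup L/\min L$, and let $\rho(\{0\})=1$. A distance of $L$ is a $d\in\mathbb N$ such that there is an $a\in L$ with $a+d\in L$ and with no element of $L$ strictly between $a$ and $a+d$; $\Delta(H)$ is the set of all distances of all $L\in\mathcal L(H)$. If $H\neq H^\times$, then $\rho_k(H)=\sup\{\sup L\mid k\in L\in\mathcal L(H)\}$ for $k\in\mathbb N$. $H$ is strongly primary if $\mathfrak m\ne\emptyset$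 and for every $a\in\mathfrak m$ there is an $n\in\mathbb N$ with $\mathfrak m^n\subset aH$; the smallest such $n$ is denoted by $\mathcal M(a)$. For a subset $G_0$ of an abelian group, $\mathcal B(G_0)$ is the monoid of finite unordered sequences over $G_0$ (repetition allowed) with sum $0$, under concatenation, and $\mathcal L(G_0)=\mathcal L(\mathcal B(G_0))$. A homomorphism $\theta\colon H\to B$ to an atomic monoid $B$ is a weak transfer homomorphism if $B=B^\times\theta(H)B^\times$, $\theta^{-1}(B^\times)=H^\times$, and whenever $\theta(a)=v_1\cdots v_n$ with $a \in H$, $n\in\mathbb N$ and atoms $v_i$ of $B$, there are atoms $u_i$ of $H$ and a permutation $\tau$ of $\{1,\dots,n\}$ with $a=u_1\cdots u_n$ and $\theta(u_i)\in B^\times v_{\tau(i)}B^\times$ for all $i$. $H$ is transfer Krull if it has a weak transfer homomorphism to $\mathcal B(G_0)$ for some subset $G_0$ of some abelian group. Let $\mathsf Z(H)$ be the free abelian monoid on the set of atoms of $H_{\rm red}=H/H^\times$, and let $\mathsf Z(a)\subset\mathsf Z(H)$ be the set of formal products of atoms whose product in $H_{\rm red}$ is $aH^\times$. For $z,z'\in\mathsf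 Z(H)$ with greatest common divisor $g$ let $\mathsf d(z,z')=\max\{|g^{-1}z|,|g^{-1}z'|\}$, where $|\cdot|$ is the number of factors. An atomic monoid $H$ is locally tame if for every atom $u$ of $H_{\rm red}$ there is an $N\in\mathbb N_0$ such that for all $a\in H$ with $\mathsf Z(a)\cap u\mathsf Z(H)\neq\emptyset$ and all $z\in\mathsf Z(a)$ there is a $z'\in\mathsf Z(a)\cap u\mathsf Z(H)$ with $\mathsf d(z,z')\le N$. For $d\in\mathbb N$, $M\in\mathbb N_0$ and $\{0,d\}\subset\mathcal D\subset[0,d]$, a set $L\subset\mathbb Z$ is an AAMP (almost arithmetical multiprogression) with difference $d$, period $\mathcal D$ and bound $M$ if $L=y+(L'\cup L^*\cup L'')\subset y+\mathcal D+d\mathbb Z$ with $y\in\mathbb Z$, where $L^*$ is finite and nonempty, $\min L^*=0$, $L^*=(\mathcal D+d\mathbb Z)\cap[0,\max L^*]$, $L'\subset[-M,-1]$ and $L''\subset\max L^*+[1,M]$. **Theorem.** Let $H$ be a strongly primary monoid that is not half-factorial. 1. There is a $\beta\in\mathbb Q$ with $\beta>1$ such that $\rho(L)\ge\beta$ for all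 $L\in\mathcal L(H)$ with $\rho(L)\neq1$. 2. $\mathcal L(H)\neq\mathcal L(G_0)$ for every subset $G_0$ of every abelian group. In particular, $H$ is not transfer Krull. 3. If $\sup\{\min\mathsf L(c)\mid c\in H\}<\infty$, or if there is a $u\in H\setminus H^\times$ with $\rho_{\mathcal M(u)}(H)<\infty$, then $H$ is locally tame. If $H$ is locally tame, then $\Delta(H)$ is finite, and there is an $M\in\mathbb N_0$ such that every $L\in\mathcal L(H)$ is an AAMP with difference $\min\Delta(H)$, period $\{0,\min\Delta(H)\}$ and bound $M$. -/

import Mathlib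

open scoped Pointwise ENNReal

universe u v

namespace FactorizationTheory

section Monoids

variable {H : Type u} [Monoid H]

/-- The set of lengths of `a`: it is `{0}` if `a` is invertible, and otherwise the set of all
`k ≥ 1` such that `a` is a product of `k` atoms. -/
def setOfLengths (a : H) : Set ℕ :=
  {k | (IsUnit a ∧ k = 0) ∨
    (¬ IsUnit a ∧ 0 < k ∧
      ∃ l : List H, l.length = k ∧ (∀ x ∈ l, Irreducible x) ∧ l.prod = a)}

variable (H) in
/-- The system of sets of lengths `{L(a) | a ∈ H}`. -/
def lengthSystem : Set (Set ℕ) := Set.range (setOfLengths : H → Set ℕ)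

variable (H) in
/-- Every non-invertible element is a product of finitely many atoms. -/
def IsAtomicMonoid : Prop :=
  ∀ a : H, ¬ IsUnit a → ∃ l : List H, (∀ x ∈ l, Irreducible x) ∧ l.prod = a

variable (H) in
/-- Every set of lengths has exactly one element. -/
def IsHalfFactorial : Prop := ∀ L ∈ lengthSystem H, L.encard = 1

open Classical in
/-- The elasticity `sup A / min A` of a set of nonnegative integers, with value `1` at `{0}`. -/
noncomputable def elasticity (A : Set ℕ) : ℝ≥0∞ :=
  if A = {0} then 1 else (⨆ n ∈ A, (n : ℝ≥0∞)) / ((sInf A : ℕ) : ℝ≥0∞)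

/-- The set of distances of a set of nonnegative integers. -/
def distances (A : Set ℕ) : Set ℕ :=
  {d | 0 < d ∧ ∃ a ∈ A, a + d ∈ A ∧ ∀ c ∈ A, ¬ (a < c ∧ c < a + d)}

variable (H) in
/-- The set of distances of a monoid. -/
def distanceSet : Set ℕ := ⋃ L ∈ lengthSystem H, distances L

open Classical in
variable (H) in
/-- The `k`-th elasticity of a monoid. -/
noncomputable def kthElasticity (k : ℕ) : ℕ∞ :=
  if ∀ a : H, IsUnit a then (k : ℕ∞)
  else ⨆ L ∈ {L | L ∈ lengthSystem H ∧ k ∈ L}, ⨆ n ∈ L, (n : ℕ∞)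

/-- Weak transfer homomorphisms of (not necessarily commutative) monoids. -/
structure IsWeakTransferHom {B : Type v} [Monoid B] (θ : H →* B) : Prop where
  atomic : IsAtomicMonoid B
  surj : ∀ b : B, ∃ (ε η : Bˣ) (a : H), b = ε * θ a * η
  isUnit_iff : ∀ a : H, IsUnit (θ a) ↔ IsUnit a
  lift : ∀ (a : H) (n : ℕ), 0 < n → ∀ w : Fin n → B, (∀ i, Irreducible (w i)) →
    θ a = (List.ofFn w).prod →
    ∃ (x : Fin n → H) (τ : Equiv.Perm (Fin n)),
      (∀ i, Irreducible (x i)) ∧ a = (List.ofFn x).prod ∧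
      ∀ i, ∃ ε η : Bˣ, θ (x i) = ε * w (τ i) * η

end Monoids

/-- The zero-sum sequences over `G₀`, inside the free abelian monoid with basis `G₀`
(written additively, as multisets of elements of `G₀`). -/
def zeroSumSequences {G : Type v} [AddCommGroup G] (G₀ : Set G) : AddSubmonoid (Multiset G₀) where
  carrier := {S | (S.map (fun g : G₀ => (g : G))).sum = 0}
  zero_mem' := by simp
  add_mem' := by
    intro a b ha hb
    simp only [Set.mem_ofPred_eq] at ha hb ⊢
    rw [Multiset.map_add, Multiset.sum_add, ha, hb, add_zero]

/-- The monoid `B(G₀)` of zero-sum sequences over `G₀`, written multiplicatively. -/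
abbrev ZeroSumMonoid {G : Type v} [AddCommGroup G] (G₀ : Set G) : Type v :=
  Multiplicative (zeroSumSequences G₀)

/-- `H` has a weak transfer homomorphism to `B(G₀)` for a subset `G₀` of an abelian group. -/
def IsTransferKrull (H : Type u) [Monoid H] : Prop :=
  ∃ (G : Type v) (_ : AddCommGroup G) (G₀ : Set G) (θ : H →* ZeroSumMonoid G₀),
    IsWeakTransferHom θ

section Commutative

variable (H : Type u) [CancelCommMonoid H]

/-- Strongly primary monoids; `nonunits H` is the set of non-invertible elements, and its
`n`-th power is the set of all products of `n` non-invertible elements. -/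
def IsStronglyPrimary : Prop :=
  (nonunits H).Nonempty ∧
    ∀ a ∈ nonunits H, ∃ n : ℕ, 0 < n ∧ nonunits H ^ n ⊆ {x | a ∣ x}

variable {H}

/-- The smallest `n ≥ 1` such that every product of `n` non-invertible elements is divisible
by `a` (used for non-invertible `a` in strongly primary monoids). -/
noncomputable def primaryExponent (a : H) : ℕ :=
  sInf {n : ℕ | 0 < n ∧ nonunits H ^ n ⊆ {x | a ∣ x}}

variable (H) in
/-- The factorization monoid: the free abelian monoid (written additively, as multisets) on the
atoms of the reduced monoid `Associates H` associated with `H`. -/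
abbrev Factorization : Type u := Multiset {p : Associates H // Irreducible p}

/-- The factorizations of `a`. -/
def factorizations (a : H) : Set (Factorization H) :=
  {z | (z.map (fun p : {p : Associates H // Irreducible p} => (p : Associates H))).prod
    = Associates.mk a}

open Classical in
/-- The distance of two factorizations: cancel the greatest common divisor of `z` and `z'`, and
take the maximum of the two remaining lengths. -/
noncomputable def factorizationDist (z z' : Factorization H) : ℕ :=
  max (Multiset.card (z - z ∩ z')) (Multiset.card (z' - z ∩ z'))

/-- The tame degree `t(a, x)`: the smallest `N` such that, if some factorization of `a` is
divisible by `x`, then for every factorization `z` of `a` there is a factorization of `a` that is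
divisible by `x` and has distance at most `N` from `z`. -/
noncomputable def tameDegree (a : H) (x : Factorization H) : ℕ∞ :=
  sInf {N : ℕ∞ | (∃ z' ∈ factorizations a, x ≤ z') →
    ∀ z ∈ factorizations a, ∃ z' ∈ factorizations a,
      x ≤ z' ∧ (factorizationDist z z' : ℕ∞) ≤ N}

variable (H) in
/-- An atomic monoid is locally tame if, for every atom `p` of the reduced monoid, the tame degrees
`t(a, p)`, `a ∈ H`, are bounded. -/
def IsLocallyTame : Prop :=
  IsAtomicMonoid H ∧
    ∀ p : {p : Associates H // Irreducible p}, (⨆ a : H, tameDegree a {p}) < ⊤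

end Commutative

/-- Almost arithmetical multiprogressions with difference `d`, period `D` and bound `M`. Here
`Lc` is the central part, `L₁` the initial part and `L₂` the end part. -/
def IsAAMP (d : ℕ) (D : Set ℤ) (M : ℕ) (L : Set ℤ) : Prop :=
  0 < d ∧ {0, (d : ℤ)} ⊆ D ∧ D ⊆ Set.Icc 0 (d : ℤ) ∧
  ∃ (y m : ℤ) (L₁ Lc L₂ : Set ℤ),
    L = {y} + (L₁ ∪ Lc ∪ L₂) ∧
    L ⊆ {y} + D + Set.range (fun k : ℤ => (d : ℤ) * k) ∧
    Lc.Finite ∧ IsLeast Lc 0 ∧ IsGreatest Lc m ∧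
    Lc = (D + Set.range (fun k : ℤ => (d : ℤ) * k)) ∩ Set.Icc 0 m ∧
    L₁ ⊆ Set.Icc (-(M : ℤ)) (-1) ∧
    L₂ ⊆ Set.Icc (m + 1) (m + M)

end FactorizationTheory

open FactorizationTheory

namespace FactorizationTheory

/-! As `H` is not half-factorial, some `a` has lengths `k` and `k + d` with `d > 0`. Strong
primariness spreads this defect: an element with a length at least `q * primaryExponent a` is
divisible by `a ^ q`, hence has two lengths that differ by at least `q` (`exists_length_spread`).

Elasticity gap: the spread of a length set that is not a singleton is at least a fixed fraction of
its minimum. Not transfer Krull: an element with length `primaryExponent a` is a multiple of `a`, so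
the singleton of that number is not a length set of `H`. In a nontrivial `B(G₀)` every singleton
occurs, because powers of a suitable atom factor uniquely (`exists_minimal_zeroSum`). Weak transfer
homomorphisms preserve length sets.

Local tameness: to bring an atom `u` into a factorization, it suffices to rewrite at most
`primaryExponent u` of its atoms, so only the length of the cofactor has to be controlled
(`isLocallyTame_of_bounded_cofactor`). Conversely, in a locally tame monoid the lengths of `a * b`
stay close to those of `b` shifted by a length of `a`. This bounds the distances, by some `D`. Every
element with a large length is `a ^ D * r`, where `a` realizes the minimal distance; the lengths of
`a ^ D` fill the gaps of the length set of `r`, and tameness bounds what lies outside the filled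
range. -/

theorem exists_le_card_eq {α : Type*} {n : ℕ} {s : Multiset α} (h : n ≤ s.card) :
    ∃ t ≤ s, t.card = n := by
  refine Quotient.inductionOn s (fun l hl => ?_) h
  exact ⟨l.take n, (l.take_sublist n).subperm, by simpa using hl⟩

/-! ### Arithmetic of sets of lengths. -/

section CommMonoid

variable {H : Type u} [CommMonoid H]

/-- Working up to associates merges the cases of the definition: units correspond to the empty
multiset, and otherwise the stray unit is absorbed into one atom. -/
theorem mem_setOfLengths_iff {a : H} {k : ℕ} :
    k ∈ setOfLengths a ↔ ∃ s : Multiset H, s.card = k ∧ (∀ x ∈ s, Irreducible x) ∧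
      Associated s.prod a := by
  constructor
  · rintro (⟨ha, rfl⟩ | ⟨-, -, l, rfl, hl, rfl⟩)
    · exact ⟨0, rfl, by simp, by simpa using (associated_one_iff_isUnit.2 ha).symm⟩
    · exact ⟨l, by simp, by simpa using hl, by simp⟩
  · rintro ⟨s, rfl, hs, w, hw⟩
    by_cases ha : IsUnit a
    · refine Or.inl ⟨ha, ?_⟩
      rw [Multiset.card_eq_zero, Multiset.eq_zero_iff_forall_notMem]
      intro x hx
      exact (hs x hx).not_isUnit
        (isUnit_of_dvd_unit ((Multiset.dvd_prod hx).trans ⟨w, hw.symm⟩) ha)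
    · refine Or.inr ⟨ha, ?_⟩
      induction s using Multiset.induction_on with
      | empty => exact absurd (by rw [← hw]; simp) ha
      | cons x t _ =>
        refine ⟨by simp, (x * w) :: t.toList, by simp, ?_, ?_⟩
        · intro y hy
          rcases List.mem_cons.1 hy with rfl | hy
          · exact (irreducible_mul_units w).2 (hs x (by simp))
          · exact hs y (by simp [Multiset.mem_toList.1 hy])
        · rw [List.prod_cons, Multiset.prod_toList, ← hw, Multiset.prod_cons, mul_right_comm]

theorem mem_setOfLengths_of_multiset {s : Multiset H} (hs : ∀ x ∈ s, Irreducible x) :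
    s.card ∈ setOfLengths s.prod :=
  mem_setOfLengths_iff.2 ⟨s, rfl, hs, Associated.refl _⟩

theorem setOfLengths_of_isUnit {a : H} (ha : IsUnit a) : setOfLengths a = {0} := by
  ext k
  simp [setOfLengths, ha]

theorem pos_of_mem_setOfLengths {a : H} (ha : ¬ IsUnit a) {k : ℕ} (hk : k ∈ setOfLengths a) :
    0 < k := by
  rcases hk with ⟨h, -⟩ | ⟨-, h, -⟩
  exacts [absurd h ha, h]

theorem add_mem_setOfLengths {a b : H} {k l : ℕ} (hk : k ∈ setOfLengths a)
    (hl : l ∈ setOfLengths b) : k + l ∈ setOfLengths (a * b) := by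
  obtain ⟨s, rfl, hs, hsa⟩ := mem_setOfLengths_iff.1 hk
  obtain ⟨t, rfl, ht, hta⟩ := mem_setOfLengths_iff.1 hl
  refine mem_setOfLengths_iff.2 ⟨s + t, by simp, ?_, ?_⟩
  · intro x hx
    rcases Multiset.mem_add.1 hx with hx | hx
    exacts [hs x hx, ht x hx]
  · rw [Multiset.prod_add]
    exact hsa.mul_mul hta

theorem one_mem_setOfLengths {u : H} (hu : Irreducible u) : 1 ∈ setOfLengths u :=
  mem_setOfLengths_iff.2 ⟨{u}, by simp, by simpa using hu, by simp⟩

theorem mul_mem_setOfLengths_pow {a : H} {k : ℕ} (hk : k ∈ setOfLengths a) (q : ℕ) :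
    q * k ∈ setOfLengths (a ^ q) := by
  induction q with
  | zero => simp [setOfLengths]
  | succ q ih =>
    rw [add_mul, one_mul, pow_succ]
    exact add_mem_setOfLengths ih hk

/-- Mixing two factorizations of `a` in the powers of `a`. -/
theorem mixed_mem_setOfLengths_pow {a : H} {k d : ℕ} (hk : k ∈ setOfLengths a)
    (hd : k + d ∈ setOfLengths a) {q i : ℕ} (hi : i ≤ q) :
    q * k + i * d ∈ setOfLengths (a ^ q) := by
  obtain ⟨j, rfl⟩ := Nat.exists_eq_add_of_le hi
  have := add_mem_setOfLengths (mul_mem_setOfLengths_pow hd i) (mul_mem_setOfLengths_pow hk j)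
  rw [← pow_add] at this
  convert this using 1
  ring

theorem setOfLengths_of_irreducible {u : H} (hu : Irreducible u) : setOfLengths u = {1} := by
  refine Set.eq_singleton_iff_unique_mem.2 ⟨one_mem_setOfLengths hu, ?_⟩
  intro k hk
  obtain ⟨s, rfl, hs, hsu⟩ := mem_setOfLengths_iff.1 hk
  rcases Multiset.empty_or_exists_mem s with rfl | ⟨x, hx⟩
  · exact absurd (associated_one_iff_isUnit.1 (by simpa using hsu.symm)) hu.not_isUnit
  · obtain ⟨t, rfl⟩ := Multiset.exists_cons_of_mem hx
    rcases Multiset.empty_or_exists_mem t with rfl | ⟨y, hy⟩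
    · simp
    · have h := hsu.symm.irreducible hu
      rw [Multiset.prod_cons] at h
      rcases h.isUnit_or_isUnit rfl with h | h
      · exact absurd h (hs x (by simp)).not_isUnit
      · exact absurd (isUnit_of_dvd_unit (Multiset.dvd_prod hy) h)
          (hs y (by simp [hy])).not_isUnit

theorem irreducible_of_one_mem_setOfLengths {u : H} (hu : 1 ∈ setOfLengths u) :
    Irreducible u := by
  obtain ⟨s, hs1, hs, hsu⟩ := mem_setOfLengths_iff.1 hu
  obtain ⟨x, rfl⟩ := Multiset.card_eq_one.1 hs1
  exact hsu.irreducible (by simpa using hs)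

theorem setOfLengths_nonempty (hH : IsAtomicMonoid H) (a : H) : (setOfLengths a).Nonempty := by
  by_cases ha : IsUnit a
  · exact ⟨0, Or.inl ⟨ha, rfl⟩⟩
  · obtain ⟨l, hl, rfl⟩ := hH a ha
    exact ⟨_, mem_setOfLengths_iff.2 ⟨l, rfl, by simpa using hl, by simp⟩⟩

theorem setOfLengths_congr {a b : H} (h : Associated a b) : setOfLengths a = setOfLengths b := by
  ext k
  simp only [mem_setOfLengths_iff]
  exact ⟨fun ⟨s, h1, h2, h3⟩ => ⟨s, h1, h2, h3.trans h⟩,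
    fun ⟨s, h1, h2, h3⟩ => ⟨s, h1, h2, h3.trans h.symm⟩⟩

theorem irreducible_associatesMk_iff {a : H} : Irreducible (Associates.mk a) ↔ Irreducible a := by
  simp only [irreducible_iff, Associates.isUnit_mk, Associates.forall_associated,
    Associates.mk_mul_mk, Associates.mk_eq_mk_iff_associated, Associated.comm (x := a)]
  apply Iff.rfl.and
  constructor
  · rintro h x y rfl
    exact h _ _ <| .refl _
  · rintro h x y ⟨u, rfl⟩
    simpa using h (mul_assoc _ _ _)

theorem mem_setOfLengths_iff_exists_factorization {H : Type u} [CancelCommMonoid H] {a : H}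
    {k : ℕ} : k ∈ setOfLengths a ↔ ∃ z ∈ factorizations a, Multiset.card z = k := by
  rw [mem_setOfLengths_iff]
  constructor
  · rintro ⟨s, rfl, hs, hsa⟩
    refine ⟨s.pmap (fun x hx => ⟨Associates.mk x, irreducible_associatesMk_iff.2 hx⟩) hs, ?_, by simp⟩
    rw [factorizations, Set.mem_ofPred_eq, Multiset.map_pmap, Multiset.pmap_eq_map,
      Associates.prod_mk, Associates.mk_eq_mk_iff_associated]
    exact hsa
  · rintro ⟨z, hz, rfl⟩
    refine ⟨z.map fun p : {p : Associates H // Irreducible p} => Quot.out p.1, by simp, ?_, ?_⟩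
    · intro x hx
      obtain ⟨p, -, rfl⟩ := Multiset.mem_map.1 hx
      rw [← irreducible_associatesMk_iff, Associates.quot_out]
      exact p.2
    · rw [← Associates.mk_eq_mk_iff_associated, ← Associates.prod_mk, Multiset.map_map,
        ← show _ = Associates.mk a from hz]
      congr 1
      exact Multiset.map_congr rfl fun p _ => Associates.quot_out p.1

end CommMonoid

/-! ### Divisibility and finiteness in strongly primary monoids. -/

section StronglyPrimary

variable {H : Type u} [CancelCommMonoid H]

theorem multiset_prod_mem_pow {S : Set H} {s : Multiset H} (hs : ∀ x ∈ s, x ∈ S) :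
    s.prod ∈ S ^ s.card := by
  induction s using Multiset.induction_on with
  | empty => simp
  | cons x t ih =>
    rw [Multiset.prod_cons, Multiset.card_cons, pow_succ']
    exact Set.mul_mem_mul (hs x (by simp)) (ih fun y hy => hs y (by simp [hy]))

theorem primaryExponent_spec (hH : IsStronglyPrimary H) (a : H) :
    0 < primaryExponent a ∧ nonunits H ^ primaryExponent a ⊆ {x | a ∣ x} := by
  refine Nat.sInf_mem (s := {n : ℕ | 0 < n ∧ nonunits H ^ n ⊆ {x | a ∣ x}}) ?_
  by_cases ha : IsUnit a
  · exact ⟨1, one_pos, fun x _ => ha.dvd⟩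
  · exact hH.2 a ha

theorem dvd_prod_of_primaryExponent_le (hH : IsStronglyPrimary H) {a : H} {s : Multiset H}
    (hs : ∀ x ∈ s, ¬ IsUnit x) (h : primaryExponent a ≤ s.card) : a ∣ s.prod := by
  obtain ⟨t, hts, ht⟩ := exists_le_card_eq h
  refine dvd_trans ?_ (Multiset.prod_dvd_prod_of_le hts)
  apply (primaryExponent_spec hH a).2
  rw [← ht]
  exact multiset_prod_mem_pow fun x hx => hs x (Multiset.mem_of_le hts hx)

theorem dvd_of_mem_setOfLengths (hH : IsStronglyPrimary H) {a b : H} {k : ℕ}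
    (hk : k ∈ setOfLengths b) (h : primaryExponent a ≤ k) : a ∣ b := by
  obtain ⟨s, rfl, hs, hsb⟩ := mem_setOfLengths_iff.1 hk
  exact (dvd_prod_of_primaryExponent_le hH (fun x hx => (hs x hx).not_isUnit) h).trans hsb.dvd

/-- With more atoms than this, `a` would divide the product of all but one of them, and cancellation
would make the omitted atom a unit. -/
theorem le_primaryExponent_of_mem_setOfLengths (hH : IsStronglyPrimary H) {a : H} {k : ℕ}
    (hk : k ∈ setOfLengths a) : k ≤ primaryExponent a := by
  obtain ⟨s, rfl, hs, hsa⟩ := mem_setOfLengths_iff.1 hk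
  by_contra! h
  obtain ⟨x, hx⟩ := Multiset.card_pos_iff_exists_mem.1 (by omega : 0 < s.card)
  obtain ⟨t, rfl⟩ := Multiset.exists_cons_of_mem hx
  rw [Multiset.card_cons] at h
  have h1 : a ∣ t.prod := dvd_prod_of_primaryExponent_le hH
    (fun y hy => (hs y (by simp [hy])).not_isUnit) (by omega)
  have h2 : x * t.prod ∣ t.prod := by
    rw [← Multiset.prod_cons]
    exact hsa.dvd.trans h1
  obtain ⟨c, hc⟩ := h2
  have h3 : x * c = 1 := by
    have : t.prod * (x * c) = t.prod * 1 := by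
      rw [mul_one]; nth_rewrite 2 [hc]; ac_rfl
    exact mul_left_cancel this
  exact (hs x (by simp)).not_isUnit (IsUnit.of_mul_eq_one c h3)

/-- From a non-unit that is not a product of atoms one can split off non-units forever, keeping a
bad cofactor. After `primaryExponent a` splittings `a` divides the part split off, so the cofactor
is a unit. -/
theorem IsStronglyPrimary.isAtomicMonoid (hH : IsStronglyPrimary H) : IsAtomicMonoid H := by
  intro a ha
  by_contra hbad
  have key : ∀ n : ℕ, ∃ s : Multiset H, s.card = n ∧ (∀ x ∈ s, ¬ IsUnit x) ∧ ∃ b : H,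
      ¬ IsUnit b ∧ (¬ ∃ l : List H, (∀ x ∈ l, Irreducible x) ∧ l.prod = b) ∧ s.prod * b = a := by
    intro n
    induction n with
    | zero => exact ⟨0, rfl, by simp, a, ha, hbad, by simp⟩
    | succ n ih =>
      obtain ⟨s, rfl, hs, b, hb, hbb, hab⟩ := ih
      have hirr : ¬ Irreducible b := fun h => hbb ⟨[b], by simpa using h, by simp⟩
      obtain ⟨x, y, hxy, hx, hy⟩ : ∃ x y, b = x * y ∧ ¬ IsUnit x ∧ ¬ IsUnit y := by
        by_contra! hcon
        exact hirr ⟨hb, fun {x y} hxy => or_iff_not_imp_left.2 (hcon x y hxy)⟩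
      have step : ∀ x y : H, b = x * y → ¬ IsUnit x → ¬ IsUnit y →
          (¬ ∃ l : List H, (∀ x ∈ l, Irreducible x) ∧ l.prod = y) →
          ∃ s' : Multiset H, s'.card = s.card + 1 ∧ (∀ x ∈ s', ¬ IsUnit x) ∧ ∃ b : H,
            ¬ IsUnit b ∧ (¬ ∃ l : List H, (∀ x ∈ l, Irreducible x) ∧ l.prod = b) ∧
              s'.prod * b = a := by
        intro x y hxy hx hy hyb
        refine ⟨x ::ₘ s, by simp, ?_, y, hy, hyb, ?_⟩
        · intro z hz
          rcases Multiset.mem_cons.1 hz with rfl | hz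
          exacts [hx, hs z hz]
        · rw [Multiset.prod_cons, ← hab, hxy]; ac_rfl
      by_cases hyb : ∃ l : List H, (∀ x ∈ l, Irreducible x) ∧ l.prod = y
      · refine step y x (hxy.trans (mul_comm _ _)) hy hx fun ⟨l, hl, hlx⟩ => hbb ?_
        obtain ⟨l', hl', hly⟩ := hyb
        refine ⟨l ++ l', ?_, by rw [List.prod_append, hlx, hly, hxy]⟩
        intro z hz
        rcases List.mem_append.1 hz with hz | hz
        exacts [hl z hz, hl' z hz]
      · exact step x y hxy hx hy hyb
  obtain ⟨s, hcard, hs, b, hb, -, hab⟩ := key (primaryExponent a)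
  obtain ⟨c, hc⟩ := dvd_prod_of_primaryExponent_le hH hs hcard.ge
  have : a * (b * c) = a * 1 := by
    rw [mul_one]; nth_rewrite 2 [← hab]; rw [hc]; ac_rfl
  exact hb (IsUnit.of_mul_eq_one c (mul_left_cancel this))

theorem setOfLengths_finite (hH : IsStronglyPrimary H) (a : H) : (setOfLengths a).Finite :=
  (Set.finite_Iic (primaryExponent a)).subset
    fun _ hk => le_primaryExponent_of_mem_setOfLengths hH hk

theorem IsStronglyPrimary.exists_irreducible (hH : IsStronglyPrimary H) :
    ∃ u : H, Irreducible u := by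
  obtain ⟨a, ha⟩ := hH.1
  obtain ⟨l, hl, rfl⟩ := hH.isAtomicMonoid a ha
  cases l with
  | nil => simp at ha
  | cons x l => exact ⟨x, hl x (by simp)⟩

theorem exists_two_lengths (hH : IsStronglyPrimary H) (hnhf : ¬ IsHalfFactorial H) :
    ∃ (a : H) (k d : ℕ), 0 < d ∧ k ∈ setOfLengths a ∧ k + d ∈ setOfLengths a := by
  simp only [IsHalfFactorial, lengthSystem, Set.forall_mem_range, not_forall] at hnhf
  obtain ⟨a, ha⟩ := hnhf
  have hne := setOfLengths_nonempty hH.isAtomicMonoid a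
  have : ¬ (setOfLengths a).Subsingleton := fun h =>
    ha (Set.encard_eq_one.2 (h.eq_empty_or_singleton.resolve_left hne.ne_empty))
  rw [Set.not_subsingleton_iff] at this
  obtain ⟨k, hk, l, hl, hkl⟩ := this.exists_lt
  exact ⟨a, k, l - k, by omega, hk, by rwa [Nat.add_sub_cancel' hkl.le]⟩

/-- The atoms of `b` contain `q` disjoint blocks of size `primaryExponent a`, and `a` divides the
product of each block. -/
theorem pow_dvd_of_mem_setOfLengths (hH : IsStronglyPrimary H) {a : H} (q : ℕ) {b : H} {k : ℕ}
    (hk : k ∈ setOfLengths b) (h : q * primaryExponent a ≤ k) : a ^ q ∣ b := by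
  induction q generalizing b k with
  | zero => simp
  | succ q ih =>
    obtain ⟨s, rfl, hs, hsb⟩ := mem_setOfLengths_iff.1 hk
    rw [add_mul, one_mul] at h
    obtain ⟨t, hts, ht⟩ := exists_le_card_eq ((Nat.le_add_right _ _).trans h)
    obtain ⟨r, rfl⟩ := Multiset.le_iff_exists_add.1 hts
    rw [Multiset.card_add] at h
    refine dvd_trans ?_ hsb.dvd
    rw [Multiset.prod_add, pow_succ]
    refine mul_dvd_mul (ih (mem_setOfLengths_of_multiset fun x hx => hs x (by simp [hx])) ht.ge) ?_
    exact dvd_of_mem_setOfLengths hH (mem_setOfLengths_of_multiset fun x hx => hs x (by simp [hx]))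
      (by omega)

end StronglyPrimary

/-! ### The elasticity gap and a missing singleton. -/

section Elasticity

variable {H : Type u} [CancelCommMonoid H]

theorem natCast_div_le_elasticity {A : Set ℕ} {m n : ℕ} (hA : A ≠ {0}) (hm : sInf A = m)
    (hn : n ∈ A) : (n : ℝ≥0∞) / (m : ℝ≥0∞) ≤ elasticity A := by
  rw [elasticity, if_neg hA, hm]
  exact ENNReal.div_le_div_right (le_iSup₂ (f := fun (n : ℕ) (_ : n ∈ A) => (n : ℝ≥0∞)) n hn) _

theorem elasticity_singleton (n : ℕ) : elasticity {n} = 1 := by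
  rw [elasticity]
  split_ifs with h
  · rfl
  · have : (n : ℝ≥0∞) ≠ 0 := fun h0 => h (by rw [Nat.cast_eq_zero.1 h0])
    simp [ENNReal.div_self this]

theorem exists_length_spread (hH : IsStronglyPrimary H) {a : H} {k d : ℕ} (hd : 0 < d)
    (hk : k ∈ setOfLengths a) (hkd : k + d ∈ setOfLengths a) {b : H} {N : ℕ}
    (hN : N ∈ setOfLengths b) :
    ∃ l l' : ℕ, l ∈ setOfLengths b ∧ l' ∈ setOfLengths b ∧ l + N / primaryExponent a ≤ l' := by
  obtain ⟨c, rfl⟩ := pow_dvd_of_mem_setOfLengths hH (N / primaryExponent a) hN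
    (Nat.div_mul_le_self _ _)
  obtain ⟨l, hl⟩ := setOfLengths_nonempty hH.isAtomicMonoid c
  refine ⟨_, _, add_mem_setOfLengths (mul_mem_setOfLengths_pow hk _) hl,
    add_mem_setOfLengths (mul_mem_setOfLengths_pow hkd _) hl, ?_⟩
  nlinarith [Nat.zero_le (N / primaryExponent a)]

theorem exists_elasticity_gap (hH : IsStronglyPrimary H) (hnhf : ¬ IsHalfFactorial H) :
    ∃ β : ℚ, 1 < β ∧
      ∀ L ∈ lengthSystem H, elasticity L ≠ 1 → ENNReal.ofReal (β : ℝ) ≤ elasticity L := by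
  obtain ⟨a, k, d, hd, hk, hkd⟩ := exists_two_lengths hH hnhf
  set n := primaryExponent a with hn
  have hn0 : 0 < n := (primaryExponent_spec hH a).1
  refine ⟨1 + 1 / (2 * n), by simpa using hn0, ?_⟩
  rintro _ ⟨b, rfl⟩ hb
  have hne := setOfLengths_nonempty hH.isAtomicMonoid b
  obtain ⟨N, hN, hmax⟩ := Set.exists_max_image _ id (setOfLengths_finite hH b) hne
  have hbu : ¬ IsUnit b := fun hu => hb (by rw [setOfLengths_of_isUnit hu, elasticity_singleton])
  have hm := Nat.sInf_mem hne
  set m := sInf (setOfLengths b) with hmdef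
  have hmpos := pos_of_mem_setOfLengths hbu hm
  have hmN : m < N := by
    rcases (Nat.sInf_le hN : m ≤ N).lt_or_eq with h | h
    · exact h
    · refine absurd ?_ hb
      rw [show setOfLengths b = {N} from Set.eq_singleton_iff_unique_mem.2 ⟨hN, fun l hl =>
        le_antisymm (hmax l hl) (h ▸ Nat.sInf_le hl)⟩, elasticity_singleton]
  -- The spread `N - m` is at least `N / n` (rounded down) and at least 1. Both are needed: together
  -- they give `N / n + 1 ≤ 2 * (N - m)`, the source of the factor 2 in `β`.
  have hspread : m ≤ 2 * n * (N - m) := by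
    obtain ⟨l, l', hl, hl', hll⟩ := exists_length_spread hH hd hk hkd hN
    have h1 : m ≤ l := Nat.sInf_le hl
    have h2 : l' ≤ N := hmax l' hl'
    rw [← hn] at hll
    have h3 : N / n ≤ N - m := by omega
    have h4 : N < n * (N / n + 1) := Nat.lt_mul_div_succ N hn0
    have h5 : N / n + 1 ≤ 2 * (N - m) := by omega
    calc m ≤ n * (N / n + 1) := by omega
      _ ≤ n * (2 * (N - m)) := Nat.mul_le_mul_left _ h5
      _ = _ := by ring
  refine le_trans ?_ (natCast_div_le_elasticity (fun h => hmpos.ne' (by simpa [h] using hm))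
    hmdef.symm hN)
  rw [← ENNReal.ofReal_natCast N, ← ENNReal.ofReal_natCast m,
    ← ENNReal.ofReal_div_of_pos (by exact_mod_cast hmpos)]
  refine ENNReal.ofReal_le_ofReal ?_
  have h1 : (m : ℝ) ≤ 2 * n * (N - m) := by
    rw [← Nat.cast_sub hmN.le]; exact_mod_cast hspread
  have hm' : (0 : ℝ) < m := by exact_mod_cast hmpos
  have hn' : (0 : ℝ) < n := by exact_mod_cast hn0
  push_cast
  rw [le_div_iff₀ hm', add_mul, one_mul, div_mul_eq_mul_div, one_mul, ← le_sub_iff_add_le',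
    div_le_iff₀ (by positivity)]
  linarith

theorem exists_singleton_notMem_lengthSystem (hH : IsStronglyPrimary H)
    (hnhf : ¬ IsHalfFactorial H) : ∃ k : ℕ, {k} ∉ lengthSystem H := by
  obtain ⟨a, k, d, hd, hk, hkd⟩ := exists_two_lengths hH hnhf
  refine ⟨primaryExponent a, ?_⟩
  rintro ⟨b, hb⟩
  have hN : primaryExponent a ∈ setOfLengths b := by rw [hb]; rfl
  obtain ⟨c, rfl⟩ := dvd_of_mem_setOfLengths hH hN le_rfl
  obtain ⟨l, hl⟩ := setOfLengths_nonempty hH.isAtomicMonoid c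
  have h1 := add_mem_setOfLengths hk hl
  have h2 := add_mem_setOfLengths hkd hl
  rw [hb, Set.mem_singleton_iff] at h1 h2
  omega

end Elasticity

/-! ### Zero-sum sequences: an atom whose powers factor uniquely. -/

section ZeroSum

variable {G : Type v} [AddCommGroup G] {G₀ : Set G}

/-- The sequence underlying an element of the monoid of zero-sum sequences. -/
def zsSeq (x : ZeroSumMonoid G₀) : Multiset G₀ := (Multiplicative.toAdd x : zeroSumSequences G₀)

theorem zsSeq_mul (x y : ZeroSumMonoid G₀) : zsSeq (x * y) = zsSeq x + zsSeq y := rfl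

theorem zsSeq_one : zsSeq (1 : ZeroSumMonoid G₀) = 0 := rfl

theorem zsSeq_pow (x : ZeroSumMonoid G₀) (n : ℕ) : zsSeq (x ^ n) = n • zsSeq x := rfl

theorem zsSeq_injective : Function.Injective (zsSeq : ZeroSumMonoid G₀ → Multiset G₀) :=
  fun _ _ h => Multiplicative.toAdd.injective (Subtype.ext h)

theorem zsSeq_eq_zero_iff {x : ZeroSumMonoid G₀} : zsSeq x = 0 ↔ x = 1 :=
  ⟨fun h => zsSeq_injective (h.trans zsSeq_one.symm), fun h => h ▸ zsSeq_one⟩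

theorem eq_one_of_isUnit {x : ZeroSumMonoid G₀} (h : IsUnit x) : x = 1 := by
  obtain ⟨y, hy⟩ := isUnit_iff_exists_inv.1 h
  have : zsSeq x + zsSeq y = 0 := by rw [← zsSeq_mul, hy, zsSeq_one]
  exact zsSeq_eq_zero_iff.1 (add_eq_zero.1 this).1

theorem exists_mul_eq_of_zsSeq_le {x y : ZeroSumMonoid G₀} (h : zsSeq x ≤ zsSeq y) :
    ∃ z, x * z = y := by
  obtain ⟨t, ht⟩ := Multiset.le_iff_exists_add.1 h
  have hx : ((zsSeq x).map (fun g : G₀ => (g : G))).sum = 0 := (Multiplicative.toAdd x).2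
  have hy : ((zsSeq y).map (fun g : G₀ => (g : G))).sum = 0 := (Multiplicative.toAdd y).2
  refine ⟨Multiplicative.ofAdd ⟨t, ?_⟩, zsSeq_injective ht.symm⟩
  rw [ht, Multiset.map_add, Multiset.sum_add, hx, zero_add] at hy
  exact hy

open Classical in
/-- A nonempty zero-sum sequence of minimal support and, among these, of minimal length divides
every nonempty zero-sum sequence with support in its own support. -/
theorem exists_minimal_zeroSum {x₀ : ZeroSumMonoid G₀} (hx₀ : x₀ ≠ 1) :
    ∃ u : ZeroSumMonoid G₀, u ≠ 1 ∧
      ∀ x, x ≠ 1 → zsSeq x ⊆ zsSeq u → zsSeq u ≤ zsSeq x := by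
  let f : ZeroSumMonoid G₀ → ℕ ×ₗ ℕ := fun x =>
    toLex ((zsSeq x).toFinset.card, (zsSeq x).card)
  obtain ⟨u, hu, hmin⟩ : ∃ u : ZeroSumMonoid G₀, u ≠ 1 ∧ ∀ x, x ≠ 1 → f u ≤ f x := by
    obtain ⟨u, hu, h⟩ := (InvImage.wf f wellFounded_lt).has_min {x | x ≠ 1} ⟨x₀, hx₀⟩
    exact ⟨u, hu, fun x hx => not_lt.1 (h x hx)⟩
  have hsupp : ∀ x, x ≠ 1 → zsSeq x ⊆ zsSeq u →
      (zsSeq x).toFinset = (zsSeq u).toFinset ∧ (zsSeq u).card ≤ (zsSeq x).card := by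
    intro x hx hxu
    have h := Prod.Lex.toLex_le_toLex.1 (hmin x hx)
    have hsub : (zsSeq x).toFinset ⊆ (zsSeq u).toFinset := Multiset.toFinset_subset.2 hxu
    have hcard := Finset.card_le_card hsub
    rcases h with h | ⟨h, h'⟩
    · exact absurd h (not_lt.2 hcard)
    · exact ⟨Finset.eq_of_subset_of_card_le hsub h.le, h'⟩
  refine ⟨u, hu, fun x hx hxu => ?_⟩
  obtain ⟨hS, hc⟩ := hsupp x hx hxu
  have hune : (zsSeq u).toFinset.Nonempty := by
    rw [Multiset.toFinset_nonempty]
    exact fun h => hu (zsSeq_eq_zero_iff.1 h)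
  -- At `g` the ratio of multiplicities `p / q` is minimal, so `u ^ p` divides `x ^ q` and the
  -- cofactor `w` does not contain `g`.
  obtain ⟨g, hg, hgmin⟩ := Finset.exists_min_image (zsSeq u).toFinset
    (fun h => ((zsSeq x).count h : ℚ) / (zsSeq u).count h) hune
  have hupos : ∀ h ∈ (zsSeq u).toFinset, 0 < (zsSeq u).count h := fun h hh =>
    Multiset.count_pos.2 (Multiset.mem_toFinset.1 hh)
  set p := (zsSeq x).count g
  set q := (zsSeq u).count g
  have hq : 0 < q := hupos g hg
  have hle : zsSeq (u ^ p) ≤ zsSeq (x ^ q) := by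
    rw [zsSeq_pow, zsSeq_pow, Multiset.le_iff_count]
    intro h
    rw [Multiset.count_nsmul, Multiset.count_nsmul]
    by_cases hh : h ∈ (zsSeq u).toFinset
    · have := hgmin h hh
      rw [div_le_div_iff₀ (by exact_mod_cast hq) (by exact_mod_cast hupos h hh)] at this
      rw [mul_comm q]
      exact_mod_cast this
    · rw [Multiset.count_eq_zero.2 fun hm => hh (Multiset.mem_toFinset.2 hm), mul_zero]
      exact Nat.zero_le _
  obtain ⟨w, hw⟩ := exists_mul_eq_of_zsSeq_le hle
  have hadd : p • zsSeq u + zsSeq w = q • zsSeq x := by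
    rw [← zsSeq_pow, ← zsSeq_pow, ← zsSeq_mul, hw]
  -- Otherwise `w` would have the full support of `u` by minimality, in particular contain `g`.
  have hw1 : w = 1 := by
    by_contra hw1
    have hsub : zsSeq w ⊆ zsSeq u := by
      intro h hh
      apply hxu
      have : h ∈ q • zsSeq x := hadd ▸ Multiset.mem_add.2 (Or.inr hh)
      exact Multiset.mem_of_mem_nsmul this
    have hgw : g ∈ zsSeq w := Multiset.mem_toFinset.1 ((hsupp w hw1 hsub).1 ▸ hg)
    have h1 := congrArg (Multiset.count g) hadd
    rw [Multiset.count_add, Multiset.count_nsmul, Multiset.count_nsmul] at h1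
    have h2 := Multiset.count_pos.2 hgw
    have h3 : p * q = q * p := mul_comm _ _
    change p * q + _ = q * p at h1
    omega
  rw [hw1, zsSeq_one, add_zero] at hadd
  -- Now `p • u = q • x`, and `u` is no longer than `x`.
  have hqp : q ≤ p := by
    have h1 := congrArg Multiset.card hadd
    rw [Multiset.card_nsmul, Multiset.card_nsmul] at h1
    have h2 : 0 < (zsSeq u).card := Multiset.card_pos.2 fun h => hu (zsSeq_eq_zero_iff.1 h)
    by_contra! hlt
    have h3 := Nat.mul_le_mul_left q hc
    have h4 := Nat.mul_lt_mul_of_pos_right hlt h2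
    omega
  rw [Multiset.le_iff_count]
  intro h
  have h1 := congrArg (Multiset.count h) hadd
  rw [Multiset.count_nsmul, Multiset.count_nsmul] at h1
  have h2 := Nat.mul_le_mul_right ((zsSeq u).count h) hqp
  exact Nat.le_of_mul_le_mul_left (h2.trans h1.le) hq

theorem singleton_mem_lengthSystem_zeroSumMonoid {x₀ : ZeroSumMonoid G₀} (hx₀ : x₀ ≠ 1) (k : ℕ) :
    {k} ∈ lengthSystem (ZeroSumMonoid G₀) := by
  obtain ⟨u, hu, hmin⟩ := exists_minimal_zeroSum hx₀
  have huu : ¬ IsUnit u := fun h => hu (eq_one_of_isUnit h)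
  have hirr : Irreducible u := by
    refine ⟨huu, fun {x y} hxy => ?_⟩
    by_cases hx : x = 1
    · exact Or.inl (hx ▸ isUnit_one)
    · right
      have hadd : zsSeq u = zsSeq x + zsSeq y := by rw [← zsSeq_mul, ← hxy]
      have hle : zsSeq x ≤ zsSeq u := hadd ▸ Multiset.le_add_right _ _
      have heq := le_antisymm hle (hmin x hx (Multiset.subset_of_le hle))
      rw [← heq, left_eq_add] at hadd
      rw [zsSeq_eq_zero_iff.1 hadd]
      exact isUnit_one
  refine ⟨u ^ k, Set.eq_singleton_iff_unique_mem.2 ⟨?_, ?_⟩⟩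
  · simpa using mul_mem_setOfLengths_pow (one_mem_setOfLengths hirr) k
  · intro l hl
    obtain ⟨s, rfl, hs, w, hsw⟩ := mem_setOfLengths_iff.1 hl
    rw [eq_one_of_isUnit w.isUnit, mul_one] at hsw
    -- An atom dividing `u ^ k` has its support inside that of `u`, so `u` divides it.
    have hall : ∀ x ∈ s, x = u := by
      intro x hx
      obtain ⟨y, hy⟩ := Multiset.dvd_prod hx
      have hx1 : x ≠ 1 := (hs x hx).ne_one
      have hsub : zsSeq x ⊆ zsSeq u := by
        intro g hg
        have : g ∈ k • zsSeq u := by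
          rw [← zsSeq_pow, ← hsw, hy, zsSeq_mul]
          exact Multiset.mem_add.2 (Or.inl hg)
        exact Multiset.mem_of_mem_nsmul this
      obtain ⟨z, hz⟩ := exists_mul_eq_of_zsSeq_le (hmin x hx1 hsub)
      have hz1 := eq_one_of_isUnit (((hs x hx).isUnit_or_isUnit hz.symm).resolve_left huu)
      rw [← hz, hz1, mul_one]
    rw [Multiset.eq_replicate_card.2 hall, Multiset.prod_replicate] at hsw
    have h1 := congrArg (fun x => (zsSeq x).card) hsw
    simp only [zsSeq_pow, Multiset.card_nsmul] at h1
    exact Nat.eq_of_mul_eq_mul_right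
      (Multiset.card_pos.2 fun h => hu (zsSeq_eq_zero_iff.1 h)) h1

end ZeroSum

/-! ### Weak transfer homomorphisms preserve length sets. -/

section TransferKrull

variable {H : Type u} [CancelCommMonoid H]

theorem lengthSystem_ne_lengthSystem_zeroSumMonoid (hH : IsStronglyPrimary H)
    (hnhf : ¬ IsHalfFactorial H) {G : Type v} [AddCommGroup G] (G₀ : Set G) :
    lengthSystem H ≠ lengthSystem (ZeroSumMonoid G₀) := by
  intro heq
  obtain ⟨k, hk⟩ := exists_singleton_notMem_lengthSystem hH hnhf
  obtain ⟨u, hu⟩ := hH.exists_irreducible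
  have h1 : ({1} : Set ℕ) ∈ lengthSystem (ZeroSumMonoid G₀) :=
    heq ▸ ⟨u, setOfLengths_of_irreducible hu⟩
  obtain ⟨x, hx⟩ := h1
  have hx1 : x ≠ 1 := by
    rintro rfl
    rw [setOfLengths_of_isUnit isUnit_one] at hx
    simp at hx
  exact hk (heq ▸ singleton_mem_lengthSystem_zeroSumMonoid hx1 k)

theorem IsWeakTransferHom.setOfLengths_map {B : Type v} [CommMonoid B] {θ : H →* B}
    (hθ : IsWeakTransferHom θ) (a : H) :
    setOfLengths (θ a) = setOfLengths a := by
  by_cases ha : IsUnit a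
  · rw [setOfLengths_of_isUnit ha, setOfLengths_of_isUnit ((hθ.isUnit_iff a).2 ha)]
  have hθa : ¬ IsUnit (θ a) := fun h => ha ((hθ.isUnit_iff a).1 h)
  have lift : ∀ b : H, ¬ IsUnit b → ∀ k ∈ setOfLengths (θ b), k ∈ setOfLengths b := by
    rintro b hb k (⟨h, -⟩ | ⟨-, hk, l, rfl, hl, hlb⟩)
    · exact absurd ((hθ.isUnit_iff b).1 h) hb
    · obtain ⟨x, τ, hx, hbx, -⟩ := hθ.lift b l.length hk l.get
        (fun i => hl _ (l.get_mem i)) (by rw [List.ofFn_get, hlb])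
      refine Or.inr ⟨hb, hk, List.ofFn x, by simp, ?_, hbx.symm⟩
      intro y hy
      obtain ⟨i, rfl⟩ := List.mem_ofFn.1 hy
      exact hx i
  refine Set.Subset.antisymm (lift a ha) ?_
  -- Any length of `θ x` lifts to a length of the atom `x`, hence is 1; that `θ x` has a length at
  -- all is the atomicity of `B`.
  have hirr : ∀ x : H, Irreducible x → Irreducible (θ x) := by
    intro x hx
    obtain ⟨k, hk⟩ := setOfLengths_nonempty hθ.atomic (θ x)
    have h1 := lift x hx.not_isUnit k hk
    rw [setOfLengths_of_irreducible hx, Set.mem_singleton_iff] at h1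
    exact irreducible_of_one_mem_setOfLengths (h1 ▸ hk)
  rintro k (⟨h, -⟩ | ⟨-, hk, l, rfl, hl, rfl⟩)
  · exact absurd h ha
  · refine Or.inr ⟨hθa, hk, l.map θ, by simp, ?_, (map_list_prod θ l).symm⟩
    intro y hy
    obtain ⟨x, hx, rfl⟩ := List.mem_map.1 hy
    exact hirr x (hl x hx)

theorem IsWeakTransferHom.lengthSystem_eq {B : Type v} [CommMonoid B] {θ : H →* B}
    (hθ : IsWeakTransferHom θ) : lengthSystem H = lengthSystem B := by
  apply Set.Subset.antisymm
  · rintro _ ⟨a, rfl⟩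
    exact ⟨θ a, hθ.setOfLengths_map a⟩
  · rintro _ ⟨b, rfl⟩
    obtain ⟨ε, η, a, rfl⟩ := hθ.surj b
    refine ⟨a, ?_⟩
    rw [← hθ.setOfLengths_map a]
    exact setOfLengths_congr ⟨ε * η, by push_cast; ac_rfl⟩

theorem not_isTransferKrull (hH : IsStronglyPrimary H) (hnhf : ¬ IsHalfFactorial H) :
    ¬ IsTransferKrull.{u, v} H := by
  rintro ⟨G, _, G₀, θ, hθ⟩
  exact lengthSystem_ne_lengthSystem_zeroSumMonoid hH hnhf G₀
    hθ.lengthSystem_eq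

end TransferKrull

/-! ### Criteria for local tameness and its effect on lengths. -/

section LocallyTame

variable {H : Type u} [CancelCommMonoid H]

theorem factorizationDist_add_right_le (z z' r : Factorization H) :
    factorizationDist (z + r) (z' + r) ≤ max z.card z'.card := by
  classical
  have hr : r ≤ (z + r) ∩ (z' + r) :=
    le_inf (Multiset.le_add_left _ _) (Multiset.le_add_left _ _)
  have key : ∀ y : Factorization H, (y + r - (z + r) ∩ (z' + r)).card ≤ y.card := by
    intro y
    refine Multiset.card_le_card ((tsub_le_tsub_left hr _).trans ?_)
    rw [add_tsub_cancel_right]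
  unfold factorizationDist
  convert max_le_max (key z) (key z')

theorem card_le_card_add_factorizationDist (z z' : Factorization H) :
    z.card ≤ z'.card + factorizationDist z z' ∧ z'.card ≤ z.card + factorizationDist z z' := by
  classical
  have h1 : (z - z ∩ z').card ≤ factorizationDist z z' := by
    unfold factorizationDist; convert le_max_left _ _
  have h2 : (z' - z ∩ z').card ≤ factorizationDist z z' := by
    unfold factorizationDist; convert le_max_right _ _
  have hl : z ∩ z' ≤ z := inf_le_left
  have hr : z ∩ z' ≤ z' := inf_le_right
  rw [Multiset.card_sub hl] at h1
  rw [Multiset.card_sub hr] at h2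
  have := Multiset.card_le_card hl
  have := Multiset.card_le_card hr
  omega

theorem add_mem_factorizations {a b : H} {z z' : Factorization H} (hz : z ∈ factorizations a)
    (hz' : z' ∈ factorizations b) : z + z' ∈ factorizations (a * b) := by
  simp only [factorizations, Set.mem_ofPred_eq] at hz hz' ⊢
  rw [Multiset.map_add, Multiset.prod_add, hz, hz', Associates.mk_mul_mk]

theorem singleton_mem_factorizations {u : H} (hu : Irreducible (Associates.mk u)) :
    {⟨Associates.mk u, hu⟩} ∈ factorizations u := by
  simp [factorizations]

theorem exists_mem_factorizations (z : Factorization H) : ∃ a : H, z ∈ factorizations a := by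
  obtain ⟨a, ha⟩ := Associates.mk_surjective
    (z.map (fun p : {p : Associates H // Irreducible p} => (p : Associates H))).prod
  exact ⟨a, ha.symm⟩

theorem associated_of_mem_factorizations {a b : H} {z : Factorization H}
    (ha : z ∈ factorizations a) (hb : z ∈ factorizations b) : Associated a b :=
  Associates.mk_eq_mk_iff_associated.1 (ha.symm.trans hb)

theorem factorizations_congr {a b : H} (h : Associated a b) :
    factorizations a = factorizations b := by
  unfold factorizations
  rw [Associates.mk_eq_mk_iff_associated.2 h]

theorem associated_of_mul_left_cancel {a b c : H} (h : Associated (a * b) (a * c)) :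
    Associated b c := by
  obtain ⟨w, hw⟩ := h
  exact ⟨w, mul_left_cancel ((mul_assoc a b w).symm.trans hw)⟩

theorem isLocallyTame_of_bounded_cofactor (hH : IsStronglyPrimary H)
    (h : ∀ n : ℕ, ∃ C : ℕ, ∀ u b : H, ∀ k ≤ n, Irreducible u → k ∈ setOfLengths (u * b) →
      ∃ l ∈ setOfLengths b, l ≤ C) : IsLocallyTame H := by
  refine ⟨hH.isAtomicMonoid, ?_⟩
  rintro ⟨p, hp⟩
  obtain ⟨u, rfl⟩ := Associates.mk_surjective p
  have hu : Irreducible u := irreducible_associatesMk_iff.1 hp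
  obtain ⟨C, hC⟩ := h (primaryExponent u)
  set n := primaryExponent u
  refine lt_of_le_of_lt (iSup_le fun a => sInf_le ?_) (ENat.natCast_lt_top (max n (C + 1)))
  rintro ⟨z₀, hz₀, hpz₀⟩ z hz
  -- Only the part `z₁` of `z`, of length at most `n`, is replaced. Its product `c` is divisible by
  -- `u`: by strong primariness if `z` has at least `n` atoms, and otherwise because `z₁` is all of
  -- `z`.
  obtain ⟨z₁, hz₁, hcard⟩ := exists_le_card_eq (min_le_right n z.card)
  obtain ⟨r, rfl⟩ := Multiset.le_iff_exists_add.1 hz₁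
  obtain ⟨c, hc⟩ := exists_mem_factorizations z₁
  obtain ⟨e, he⟩ := exists_mem_factorizations r
  have hce := associated_of_mem_factorizations (add_mem_factorizations hc he) hz
  have hcl : z₁.card ∈ setOfLengths c := mem_setOfLengths_iff_exists_factorization.2 ⟨z₁, hc, rfl⟩
  have huc : u ∣ c := by
    rcases le_total n (z₁ + r).card with hle | hle
    · rw [min_eq_left hle] at hcard
      exact dvd_of_mem_setOfLengths hH hcl hcard.ge
    · rw [min_eq_right hle, Multiset.card_add] at hcard
      have hr : r = 0 := Multiset.card_eq_zero.1 (by omega)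
      subst hr
      rw [add_zero] at hz
      have hac := associated_of_mem_factorizations hz hc
      obtain ⟨y, rfl⟩ := Multiset.le_iff_exists_add.1 hpz₀
      obtain ⟨f, hf⟩ := exists_mem_factorizations y
      have := associated_of_mem_factorizations
        (add_mem_factorizations (singleton_mem_factorizations hp) hf) hz₀
      exact (dvd_mul_right u f).trans (this.trans hac).dvd
  obtain ⟨b, rfl⟩ := huc
  obtain ⟨l, hl, hlC⟩ := hC u b z₁.card (hcard ▸ min_le_left _ _) hu hcl
  obtain ⟨y, hy, rfl⟩ := mem_setOfLengths_iff_exists_factorization.1 hl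
  refine ⟨{⟨Associates.mk u, hp⟩} + y + r, ?_, ?_, ?_⟩
  · rw [← factorizations_congr hce]
    exact add_mem_factorizations (add_mem_factorizations (singleton_mem_factorizations hp) hy) he
  · rw [add_assoc]
    exact Multiset.le_add_right _ _
  · refine Nat.cast_le.2 ((factorizationDist_add_right_le _ _ _).trans (max_le_max ?_ ?_))
    · exact hcard ▸ min_le_left _ _
    · rw [Multiset.card_add, Multiset.card_singleton]
      omega

theorem isLocallyTame_of_min_bounded (hH : IsStronglyPrimary H)
    (h : (⨆ c : H, ((sInf (setOfLengths c) : ℕ) : ℕ∞)) < ⊤) : IsLocallyTame H := by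
  obtain ⟨C, hC⟩ := ENat.ne_top_iff_exists.1 h.ne
  refine isLocallyTame_of_bounded_cofactor hH fun n => ⟨C, fun u b k _ _ _ => ?_⟩
  refine ⟨_, Nat.sInf_mem (setOfLengths_nonempty hH.isAtomicMonoid b), ?_⟩
  have := le_iSup (fun c : H => ((sInf (setOfLengths c) : ℕ) : ℕ∞)) b
  rw [← hC] at this
  exact_mod_cast this

theorem exists_bound_of_kthElasticity_lt_top {a : H} (ha : ¬ IsUnit a) {k : ℕ}
    (h : kthElasticity H k < ⊤) :
    ∃ R : ℕ, ∀ b : H, k ∈ setOfLengths b → ∀ l ∈ setOfLengths b, l ≤ R := by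
  obtain ⟨R, hR⟩ := ENat.ne_top_iff_exists.1 h.ne
  rw [kthElasticity, if_neg fun hall => ha (hall a)] at hR
  refine ⟨R, fun b hb l hl => ?_⟩
  have h1 : (l : ℕ∞) ≤ ⨆ n ∈ setOfLengths b, (n : ℕ∞) :=
    le_iSup₂ (f := fun (n : ℕ) (_ : n ∈ setOfLengths b) => (n : ℕ∞)) l hl
  have h2 := le_iSup₂ (f := fun (L : Set ℕ) (_ : L ∈ {L | L ∈ lengthSystem H ∧ k ∈ L}) =>
    ⨆ n ∈ L, (n : ℕ∞)) (setOfLengths b) ⟨⟨b, rfl⟩, hb⟩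
  have := h1.trans h2
  rw [← hR] at this
  exact_mod_cast this

theorem exists_length_ge_of_pow_dvd (hH : IsAtomicMonoid H) {a e : H} (ha : ¬ IsUnit a) {T : ℕ}
    (h : a ^ T ∣ e) : ∃ l ∈ setOfLengths e, T ≤ l := by
  obtain ⟨f, rfl⟩ := h
  obtain ⟨k, hk⟩ := setOfLengths_nonempty hH a
  obtain ⟨l, hl⟩ := setOfLengths_nonempty hH f
  refine ⟨_, add_mem_setOfLengths (mul_mem_setOfLengths_pow hk T) hl, ?_⟩
  nlinarith [pos_of_mem_setOfLengths ha hk]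

theorem exists_eq_pow_mul_not_dvd (hH : IsStronglyPrimary H) {a : H} (ha : ¬ IsUnit a) (e : H) :
    ∃ (T : ℕ) (f : H), e = a ^ T * f ∧ ¬ a ∣ f := by
  classical
  have hspec := Nat.findGreatest_spec (P := fun T => a ^ T ∣ e) (Nat.zero_le (primaryExponent e))
    (by simp)
  obtain ⟨f, hf⟩ := hspec
  refine ⟨_, f, hf, ?_⟩
  rintro ⟨g, rfl⟩
  set T := Nat.findGreatest (fun T => a ^ T ∣ e) (primaryExponent e) with hT
  have hdvd : a ^ (T + 1) ∣ e := ⟨g, by rw [hf, pow_succ, mul_assoc]⟩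
  obtain ⟨l, hl, hle⟩ := exists_length_ge_of_pow_dvd hH.isAtomicMonoid ha hdvd
  have := Nat.le_findGreatest (P := fun T => a ^ T ∣ e)
    (hle.trans (le_primaryExponent_of_mem_setOfLengths hH hl)) hdvd
  omega

/-- Powers of `a` are extracted while the atoms are multiplied in one at a time. A remainder not
divisible by `a` has only lengths below `primaryExponent a`, so each new atom releases at most `R`
factors `a`. -/
theorem exists_prod_eq_pow_mul (hH : IsStronglyPrimary H) {a : H} (ha : ¬ IsUnit a) {R : ℕ}
    (hR : ∀ b : H, primaryExponent a ∈ setOfLengths b → ∀ l ∈ setOfLengths b, l ≤ R)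
    {s : Multiset H} (hs : ∀ x ∈ s, Irreducible x) :
    ∃ (S : ℕ) (e : H), S ≤ s.card * R ∧ ¬ a ∣ e ∧ s.prod = a ^ S * e := by
  induction s using Multiset.induction_on with
  | empty => exact ⟨0, 1, by simp, fun h => ha (isUnit_of_dvd_one h), by simp⟩
  | cons v t ih =>
    obtain ⟨S, e, hS, he, hprod⟩ := ih fun x hx => hs x (by simp [hx])
    have hv := hs v (by simp)
    obtain ⟨T, f, hf, haf⟩ := exists_eq_pow_mul_not_dvd hH ha (e * v)
    refine ⟨S + T, f, ?_, haf, ?_⟩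
    · obtain ⟨l, hl, hTl⟩ := exists_length_ge_of_pow_dvd hH.isAtomicMonoid ha
        (⟨f, hf⟩ : a ^ T ∣ e * v)
      obtain ⟨j, hj⟩ := setOfLengths_nonempty hH.isAtomicMonoid e
      have hjlt : j < primaryExponent a := not_le.1 fun h => he (dvd_of_mem_setOfLengths hH hj h)
      -- Padding `e * v` with copies of `v` produces the exact length `primaryExponent a`, to which
      -- `hR` applies.
      have hpow := mul_mem_setOfLengths_pow (one_mem_setOfLengths hv) (primaryExponent a - (j + 1))
      have h1 := add_mem_setOfLengths (add_mem_setOfLengths hj (one_mem_setOfLengths hv)) hpow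
      have h2 := hR _ (by convert h1 using 1; omega) _ (add_mem_setOfLengths hl hpow)
      rw [Multiset.card_cons, add_mul, one_mul]
      omega
    · rw [Multiset.prod_cons, hprod, pow_add, mul_assoc, ← hf]
      ac_rfl

/-- A length `l` forces `a ^ (l / m)` to divide `b`, while the extracted form of a product of at
most `n` atoms bounds the exponent of `a` by `n * R`. -/
theorem exists_length_bound (hH : IsStronglyPrimary H) {a : H} (ha : ¬ IsUnit a)
    (h : kthElasticity H (primaryExponent a) < ⊤) (n : ℕ) :
    ∃ C : ℕ, ∀ b : H, ∀ k ∈ setOfLengths b, k ≤ n → ∀ l ∈ setOfLengths b, l ≤ C := by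
  obtain ⟨R, hR⟩ := exists_bound_of_kthElasticity_lt_top ha h
  set m := primaryExponent a with hm
  refine ⟨m * (n * R + 1), fun b k hk hkn l hl => ?_⟩
  obtain ⟨s, rfl, hs, hsb⟩ := mem_setOfLengths_iff.1 hk
  rw [← setOfLengths_congr hsb] at hl
  obtain ⟨S, e, hS, he, hprod⟩ := exists_prod_eq_pow_mul hH ha hR hs
  have hdvd := pow_dvd_of_mem_setOfLengths hH (a := a) (l / m) hl (Nat.div_mul_le_self _ _)
  have hle : l / m ≤ S := by
    by_contra! hlt
    apply he
    obtain ⟨c, hc⟩ := (pow_dvd_pow a (show S + 1 ≤ l / m from hlt)).trans hdvd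
    rw [hprod, pow_succ, mul_assoc] at hc
    exact ⟨c, mul_left_cancel hc⟩
  have h1 : l < m * (l / m + 1) := Nat.lt_mul_div_succ l (primaryExponent_spec hH a).1
  exact h1.le.trans (Nat.mul_le_mul_left _ (Nat.succ_le_succ
    (hle.trans (hS.trans (Nat.mul_le_mul_right _ hkn)))))

theorem isLocallyTame_of_kthElasticity (hH : IsStronglyPrimary H) {a : H} (ha : ¬ IsUnit a)
    (h : kthElasticity H (primaryExponent a) < ⊤) : IsLocallyTame H := by
  refine isLocallyTame_of_bounded_cofactor hH fun n => ?_
  obtain ⟨C, hC⟩ := exists_length_bound hH ha h n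
  refine ⟨C, fun u b k hkn hu hk => ?_⟩
  obtain ⟨l, hl⟩ := setOfLengths_nonempty hH.isAtomicMonoid b
  refine ⟨l, hl, ?_⟩
  have := hC _ k hk hkn _ (add_mem_setOfLengths (one_mem_setOfLengths hu) hl)
  omega

theorem IsLocallyTame.exists_near_length_irreducible (hT : IsLocallyTame H) {u : H}
    (hu : Irreducible u) :
    ∃ T : ℕ, ∀ b : H, ∀ l ∈ setOfLengths (u * b), ∃ l' ∈ setOfLengths b,
      l ≤ l' + 1 + T ∧ l' + 1 ≤ l + T := by
  have hp := irreducible_associatesMk_iff.2 hu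
  obtain ⟨T, hTeq⟩ := ENat.ne_top_iff_exists.1 (hT.2 ⟨Associates.mk u, hp⟩).ne
  refine ⟨T, fun b l hl => ?_⟩
  obtain ⟨z, hz, rfl⟩ := mem_setOfLengths_iff_exists_factorization.1 hl
  -- The strict bound `T + 1` allows an admissible `N` to be extracted from the infimum.
  have hdeg : tameDegree (u * b) {⟨Associates.mk u, hp⟩} < ((T + 1 : ℕ) : ℕ∞) := by
    refine lt_of_le_of_lt (le_iSup (fun a : H => tameDegree a {⟨Associates.mk u, hp⟩}) (u * b)) ?_
    rw [← hTeq]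
    exact_mod_cast Nat.lt_succ_self T
  obtain ⟨N, hN, hNT⟩ := sInf_lt_iff.1 hdeg
  obtain ⟨l₀, hl₀⟩ := setOfLengths_nonempty hT.1 b
  obtain ⟨y₀, hy₀, -⟩ := mem_setOfLengths_iff_exists_factorization.1 hl₀
  obtain ⟨z', hz', hle, hdist⟩ := hN ⟨_, add_mem_factorizations
    (singleton_mem_factorizations hp) hy₀, Multiset.le_add_right _ _⟩ z hz
  obtain ⟨y, rfl⟩ := Multiset.le_iff_exists_add.1 hle
  obtain ⟨c, hc⟩ := exists_mem_factorizations y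
  have hcb := associated_of_mul_left_cancel (associated_of_mem_factorizations
    (add_mem_factorizations (singleton_mem_factorizations hp) hc) hz')
  rw [factorizations_congr hcb] at hc
  refine ⟨y.card, mem_setOfLengths_iff_exists_factorization.2 ⟨y, hc, rfl⟩, ?_⟩
  have h1 := card_le_card_add_factorizationDist z ({⟨Associates.mk u, hp⟩} + y)
  have h2 : factorizationDist z ({⟨Associates.mk u, hp⟩} + y) < T + 1 :=
    by exact_mod_cast lt_of_le_of_lt hdist hNT
  rw [Multiset.card_add, Multiset.card_singleton] at h1
  omega

theorem IsLocallyTame.exists_near_length_prod (hT : IsLocallyTame H) {s : Multiset H}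
    (hs : ∀ x ∈ s, Irreducible x) :
    ∃ T : ℕ, ∀ b : H, ∀ l ∈ setOfLengths (s.prod * b), ∃ l' ∈ setOfLengths b,
      l ≤ l' + s.card + T ∧ l' + s.card ≤ l + T := by
  induction s using Multiset.induction_on with
  | empty => exact ⟨0, fun b l hl => ⟨l, by simpa using hl, by simp⟩⟩
  | cons v t ih =>
    obtain ⟨T, hT1⟩ := ih fun x hx => hs x (by simp [hx])
    obtain ⟨T', hT2⟩ := hT.exists_near_length_irreducible (hs v (by simp))
    refine ⟨T + T', fun b l hl => ?_⟩
    rw [Multiset.prod_cons, mul_assoc] at hl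
    obtain ⟨l₁, hl₁, h1⟩ := hT2 _ l hl
    obtain ⟨l₂, hl₂, h2⟩ := hT1 _ l₁ hl₁
    refine ⟨l₂, hl₂, ?_⟩
    rw [Multiset.card_cons]
    omega

theorem IsLocallyTame.exists_near_length (hT : IsLocallyTame H) {a : H} {k : ℕ}
    (hk : k ∈ setOfLengths a) :
    ∃ T : ℕ, ∀ b : H, ∀ l ∈ setOfLengths (a * b), ∃ l' ∈ setOfLengths b,
      l ≤ l' + k + T ∧ l' + k ≤ l + T := by
  obtain ⟨s, rfl, hs, hsa⟩ := mem_setOfLengths_iff.1 hk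
  obtain ⟨T, h⟩ := hT.exists_near_length_prod hs
  refine ⟨T, fun b l hl => h b l ?_⟩
  rwa [setOfLengths_congr (hsa.mul_right b)]

end LocallyTame

/-! ### Sets of distances. -/

section Distances

theorem exists_distance_le {A : Set ℕ} {p q : ℕ} (hp : p ∈ A) (hq : q ∈ A) (hpq : p < q) :
    ∃ d ∈ distances A, d ≤ q - p := by
  have hne : {x | x ∈ A ∧ p < x}.Nonempty := ⟨q, hq, hpq⟩
  obtain ⟨hr, hpr⟩ := Nat.sInf_mem hne
  have hmin : ∀ x ∈ A, p < x → sInf {x | x ∈ A ∧ p < x} ≤ x := fun x hx h => Nat.sInf_le ⟨hx, h⟩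
  set r := sInf {x | x ∈ A ∧ p < x}
  have hrq := hmin q hq hpq
  refine ⟨r - p, ⟨by omega, p, hp, by rwa [Nat.add_sub_cancel' hpr.le], ?_⟩, by omega⟩
  rintro c hc ⟨h1, h2⟩
  have := hmin c hc h1
  omega

theorem exists_le_distance {A : Set ℕ} {p q x d : ℕ} (hp : p ∈ A) (hq : q ∈ A) (hpx : p ≤ x)
    (hxq : x + d ≤ q) (hd : 0 < d) (hA : ∀ c ∈ A, ¬ (x < c ∧ c < x + d)) :
    ∃ d' ∈ distances A, d ≤ d' := by
  classical
  have hp' : Nat.findGreatest (· ∈ A) x ∈ A := Nat.findGreatest_spec (P := (· ∈ A)) hpx hp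
  have hle := Nat.findGreatest_le (P := (· ∈ A)) x
  have hmax : ∀ c ∈ A, c ≤ x → c ≤ Nat.findGreatest (· ∈ A) x :=
    fun c hc h => Nat.le_findGreatest h hc
  set p' := Nat.findGreatest (· ∈ A) x
  have hne : {c | c ∈ A ∧ x < c}.Nonempty := ⟨q, hq, by omega⟩
  obtain ⟨hr, hxr⟩ := Nat.sInf_mem hne
  have hmin : ∀ c ∈ A, x < c → sInf {c | c ∈ A ∧ x < c} ≤ c := fun c hc h => Nat.sInf_le ⟨hc, h⟩
  set r := sInf {c | c ∈ A ∧ x < c}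
  have hrd := hA r hr
  refine ⟨r - p', ⟨by omega, p', hp', by rwa [Nat.add_sub_cancel' (by omega)], ?_⟩, by omega⟩
  rintro c hc ⟨h1, h2⟩
  rcases le_or_gt c x with h | h
  · have := hmax c hc h
    omega
  · have := hmin c hc h
    omega

variable {H : Type u} [CancelCommMonoid H]

theorem mem_distanceSet {d : ℕ} :
    d ∈ distanceSet H ↔ ∃ a : H, d ∈ distances (setOfLengths a) := by
  simp [distanceSet, lengthSystem]

theorem distanceSet_nonempty (hH : IsStronglyPrimary H) (hnhf : ¬ IsHalfFactorial H) :
    (distanceSet H).Nonempty := by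
  obtain ⟨a, k, d, hd, hk, hkd⟩ := exists_two_lengths hH hnhf
  obtain ⟨d', hd', -⟩ := exists_distance_le hk hkd (by omega)
  exact ⟨d', mem_distanceSet.2 ⟨a, hd'⟩⟩

/-- All lengths of an element are congruent modulo the minimal distance of the monoid. -/
theorem sInf_distanceSet_dvd_sub (hne : (distanceSet H).Nonempty) {b : H} {l₁ l₂ : ℕ}
    (h₁ : l₁ ∈ setOfLengths b) (h₂ : l₂ ∈ setOfLengths b) (hle : l₁ ≤ l₂) :
    sInf (distanceSet H) ∣ l₂ - l₁ := by
  obtain ⟨a, hd, k, hk, hkd, -⟩ := mem_distanceSet.1 (Nat.sInf_mem hne)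
  have hmin : ∀ d' ∈ distanceSet H, sInf (distanceSet H) ≤ d' := fun d' h => Nat.sInf_le h
  set d := sInf (distanceSet H)
  by_contra hndvd
  have hr : 0 < (l₂ - l₁) % d := Nat.pos_of_ne_zero fun h => hndvd (Nat.dvd_of_mod_eq_zero h)
  have hrd := Nat.mod_lt (l₂ - l₁) hd
  have hdm := Nat.div_add_mod' (l₂ - l₁) d
  set s := (l₂ - l₁) / d
  -- In `a ^ s * b` these two lengths differ by the remainder of `l₂ - l₁` modulo `d`, which would
  -- produce a distance below the minimal one.
  have m₁ := add_mem_setOfLengths (mixed_mem_setOfLengths_pow hk hkd (le_refl s)) h₁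
  have m₂ := add_mem_setOfLengths (mixed_mem_setOfLengths_pow hk hkd (Nat.zero_le s)) h₂
  rw [zero_mul, add_zero] at m₂
  obtain ⟨d', hd', hle'⟩ := exists_distance_le m₁ m₂ (by omega)
  have := hmin d' (mem_distanceSet.2 ⟨_, hd'⟩)
  omega

theorem IsLocallyTame.exists_distance_bound (hT : IsLocallyTame H) (hH : IsStronglyPrimary H) :
    ∃ D : ℕ, ∀ b : H, ∀ d ∈ distances (setOfLengths b), d ≤ D := by
  obtain ⟨u, hu⟩ := hH.exists_irreducible
  obtain ⟨T, hT⟩ := hT.exists_near_length_irreducible hu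
  refine ⟨max T (primaryExponent u), ?_⟩
  -- Induction on a bound for the lengths of `b`: too large a gap passes to the cofactor `c` of the
  -- atom `u`, whose lengths are smaller.
  suffices h : ∀ m : ℕ, ∀ b : H, (∀ l ∈ setOfLengths b, l ≤ m) →
      ∀ d ∈ distances (setOfLengths b), d ≤ max T (primaryExponent u) from
    fun b => h (primaryExponent b) b fun l hl => le_primaryExponent_of_mem_setOfLengths hH hl
  intro m
  induction m with
  | zero =>
    rintro b hb d ⟨hd, x, -, hxd, -⟩
    have := hb _ hxd
    omega
  | succ m ih =>
    rintro b hb d ⟨hd, x, hx, hxd, hgap⟩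
    by_contra! hlt
    rw [max_lt_iff] at hlt
    obtain ⟨c, rfl⟩ := dvd_of_mem_setOfLengths (a := u) hH hxd (by omega)
    have hsucc : ∀ l ∈ setOfLengths c, l + 1 ∈ setOfLengths (u * c) := fun l hl =>
      add_comm 1 l ▸ add_mem_setOfLengths (one_mem_setOfLengths hu) hl
    obtain ⟨x₁, hx₁, h1⟩ := hT c x hx
    obtain ⟨x₂, hx₂, h2⟩ := hT c _ hxd
    have g1 := hgap _ (hsucc x₁ hx₁)
    have g2 := hgap _ (hsucc x₂ hx₂)
    -- The lengths `x₁ + 1` and `x₂ + 1` are within `T < d` of the ends of the gap and cannot lie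
    -- inside it, so they lie on opposite sides. The gap, shifted by 1, thus survives in the length
    -- set of `c`.
    obtain ⟨d', hd', hdd'⟩ := exists_le_distance (x := x - 1) (d := d) hx₁ hx₂ (by omega)
      (by omega) hd fun l hl hcon => hgap _ (hsucc l hl) (by omega)
    have h3 := ih c (fun l hl => Nat.succ_le_succ_iff.1 (hb _ (hsucc l hl))) d' hd'
    have h4 := max_lt_iff.2 hlt
    omega

end Distances

/-! ### Structure of length sets as almost arithmetical multiprogressions. -/

section AAMP

theorem mem_pair_add_range_iff {d : ℕ} {t : ℤ} :
    t ∈ ({0, (d : ℤ)} : Set ℤ) + Set.range (fun k : ℤ => (d : ℤ) * k) ↔ (d : ℤ) ∣ t := by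
  constructor
  · rintro ⟨x, hx, _, ⟨k, rfl⟩, rfl⟩
    refine dvd_add ?_ (dvd_mul_right _ _)
    rcases hx with rfl | rfl
    exacts [dvd_zero _, dvd_rfl]
  · rintro ⟨k, rfl⟩
    exact ⟨0, by simp, _, ⟨k, rfl⟩, by simp⟩

theorem isAAMP_of_contains_progression {d y m M : ℕ} {L : Set ℕ} (hd : 0 < d) (hdm : d ∣ m)
    (hmod : ∀ x ∈ L, (d : ℤ) ∣ (x : ℤ) - y) (hmem : ∀ i, d * i ≤ m → y + d * i ∈ L)
    (hbound : ∀ x ∈ L, y ≤ x + M ∧ x ≤ y + m + M) :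
    IsAAMP d {0, (d : ℤ)} M ((fun n : ℕ => (n : ℤ)) '' L) := by
  refine ⟨hd, subset_rfl, ?_, y, m, {t | t < 0 ∧ ∃ x ∈ L, (x : ℤ) = y + t},
    {t | (d : ℤ) ∣ t ∧ 0 ≤ t ∧ t ≤ m}, {t | (m : ℤ) < t ∧ ∃ x ∈ L, (x : ℤ) = y + t},
    ?_, ?_, ?_, ?_, ?_, ?_, ?_, ?_⟩
  · rintro t (rfl | rfl) <;> simp
  · ext t
    simp only [Set.singleton_add, Set.mem_image]
    constructor
    · rintro ⟨x, hx, rfl⟩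
      refine ⟨x - y, ?_, by ring⟩
      rcases lt_or_ge ((x : ℤ) - y) 0 with h | h
      · exact Or.inl (Or.inl ⟨h, x, hx, by ring⟩)
      · rcases lt_or_ge (m : ℤ) ((x : ℤ) - y) with h' | h'
        · exact Or.inr ⟨h', x, hx, by ring⟩
        · exact Or.inl (Or.inr ⟨hmod x hx, h, h'⟩)
    · rintro ⟨t, (⟨-, x, hx, hxt⟩ | ⟨⟨k, rfl⟩, h0, hm⟩) | ⟨-, x, hx, hxt⟩, rfl⟩
      · exact ⟨x, hx, hxt⟩
      · have hk : 0 ≤ k := by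
          by_contra! hk
          have : (0 : ℤ) < d := by exact_mod_cast hd
          nlinarith
        lift k to ℕ using hk
        exact ⟨_, hmem k (by exact_mod_cast hm), by push_cast; rfl⟩
      · exact ⟨x, hx, hxt⟩
  · rintro _ ⟨x, hx, rfl⟩
    rw [add_assoc]
    exact ⟨y, rfl, x - y, mem_pair_add_range_iff.2 (hmod x hx), by simp⟩
  · exact (Set.finite_Icc (0 : ℤ) m).subset fun t ht => ht.2
  · exact ⟨⟨dvd_zero _, le_rfl, by simp⟩, fun t ht => ht.2.1⟩
  · exact ⟨⟨by exact_mod_cast hdm, by simp, le_rfl⟩, fun t ht => ht.2.2⟩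
  · ext t
    rw [Set.mem_inter_iff, mem_pair_add_range_iff]
    rfl
  · rintro t ⟨ht, x, hx, hxt⟩
    have := (hbound x hx).1
    exact ⟨by omega, by omega⟩
  · rintro t ⟨ht, x, hx, hxt⟩
    have := (hbound x hx).2
    exact ⟨by omega, by omega⟩

variable {H : Type u} [CancelCommMonoid H]

theorem sInf_distanceSet_dvd_cast_sub (hne : (distanceSet H).Nonempty) {b : H} {l₁ l₂ : ℕ}
    (h₁ : l₁ ∈ setOfLengths b) (h₂ : l₂ ∈ setOfLengths b) :
    ((sInf (distanceSet H) : ℕ) : ℤ) ∣ (l₂ : ℤ) - l₁ := by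
  rcases le_total l₁ l₂ with h | h
  · rw [← Nat.cast_sub h]
    exact_mod_cast sInf_distanceSet_dvd_sub hne h₁ h₂ h
  · rw [dvd_sub_comm, ← Nat.cast_sub h]
    exact_mod_cast sInf_distanceSet_dvd_sub hne h₂ h₁ h

theorem IsLocallyTame.exists_isAAMP (hT : IsLocallyTame H) (hH : IsStronglyPrimary H)
    (hne : (distanceSet H).Nonempty) :
    ∃ M : ℕ, ∀ L ∈ lengthSystem H,
      IsAAMP (sInf (distanceSet H)) {0, ((sInf (distanceSet H) : ℕ) : ℤ)} M
        ((fun n : ℕ => (n : ℤ)) '' L) := by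
  obtain ⟨D, hD⟩ := hT.exists_distance_bound hH
  obtain ⟨a, hd, k, hk, hkd, -⟩ := mem_distanceSet.1 (Nat.sInf_mem hne)
  have hcong : ∀ (b : H) (l₁ l₂ : ℕ), l₁ ∈ setOfLengths b → l₂ ∈ setOfLengths b →
      ((sInf (distanceSet H) : ℕ) : ℤ) ∣ (l₂ : ℤ) - l₁ :=
    fun b l₁ l₂ => sInf_distanceSet_dvd_cast_sub hne
  set d := sInf (distanceSet H)
  -- These lengths form a progression with difference `d` of extent `D * d ≥ D`, long enough to
  -- bridge every gap in a length set.
  have hmix : ∀ i ≤ D, D * k + i * d ∈ setOfLengths (a ^ D) :=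
    fun i => mixed_mem_setOfLengths_pow hk hkd
  obtain ⟨T, hT1⟩ := hT.exists_near_length (hmix 0 (Nat.zero_le _))
  obtain ⟨T', hT2⟩ := hT.exists_near_length (hmix D le_rfl)
  refine ⟨T + T' + primaryExponent (a ^ D), ?_⟩
  rintro _ ⟨b, rfl⟩
  by_cases hlong : ∃ N ∈ setOfLengths b, primaryExponent (a ^ D) ≤ N
  · obtain ⟨N, hN, hle⟩ := hlong
    obtain ⟨r, rfl⟩ := dvd_of_mem_setOfLengths hH hN hle
    have hrne := setOfLengths_nonempty hH.isAtomicMonoid r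
    obtain ⟨p, hp, hmin⟩ := Set.exists_min_image _ id (setOfLengths_finite hH r) hrne
    obtain ⟨P, hP, hmax⟩ := Set.exists_max_image _ id (setOfLengths_finite hH r) hrne
    simp only [id_eq] at hmin hmax
    have hpP := hmin P hP
    have hbase : D * k + p ∈ setOfLengths (a ^ D * r) := by
      simpa using add_mem_setOfLengths (hmix 0 (Nat.zero_le _)) hp
    refine isAAMP_of_contains_progression (y := D * k + p) (m := P - p + D * d) hd ?_
      (fun x hx => hcong _ _ _ hbase hx) ?_ ?_
    · refine dvd_add ?_ (dvd_mul_left _ _)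
      have := hcong r p P hp hP
      rw [← Nat.cast_sub hpP] at this
      exact_mod_cast this
    · intro i hi
      classical
      have hl := Nat.findGreatest_spec (P := (· ∈ setOfLengths r)) (Nat.le_add_right p (d * i)) hp
      have hlle := Nat.findGreatest_le (P := (· ∈ setOfLengths r)) (p + d * i)
      have hlmax : ∀ c ∈ setOfLengths r, c ≤ p + d * i →
          c ≤ Nat.findGreatest (· ∈ setOfLengths r) (p + d * i) :=
        fun c hc h => Nat.le_findGreatest h hc
      -- `l` is the last length of `r` up to `p + d * i`; the missing amount `d * j` is supplied by
      -- `a ^ D`, provided that `j ≤ D`.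
      set l := Nat.findGreatest (· ∈ setOfLengths r) (p + d * i)
      have hdvd : d ∣ p + d * i - l := by
        have h1 : (d : ℤ) ∣ ((p + d * i - l : ℕ) : ℤ) := by
          rw [Nat.cast_sub hlle]
          push_cast
          rw [add_sub_right_comm]
          exact dvd_add (hcong r l p hl hp) (dvd_mul_right _ _)
        exact_mod_cast h1
      obtain ⟨j, hj⟩ := hdvd
      have hjD : d * j ≤ d * D := by
        -- Beyond `P` the missing amount is at most `D * d` by the choice of `m`; below `P` it is
        -- smaller than a distance of the length set of `r`.
        rcases le_or_gt P (p + d * i) with hPi | hPi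
        · have := hlmax P hP hPi
          rw [mul_comm d D]
          omega
        · obtain ⟨d', hd', hle'⟩ := exists_le_distance (x := l) (d := p + d * i - l + 1) hl hP
            le_rfl (by omega) (by omega) fun c hc hcon => by
              have := hlmax c hc (by omega)
              omega
          have h1 := hD r d' hd'
          have h2 : D ≤ d * D := Nat.le_mul_of_pos_left D hd
          omega
      have hmem := add_mem_setOfLengths (hmix j (Nat.le_of_mul_le_mul_left hjD hd)) hl
      convert hmem using 1
      rw [mul_comm j d]
      change D * k + p + d * i = D * k + d * j + l
      omega
    · intro x hx
      -- Comparison with the shortest and the longest of the chosen lengths of `a ^ D` bounds the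
      -- overhang at the lower and the upper end.
      obtain ⟨x₁, hx₁, h1⟩ := hT1 r x hx
      obtain ⟨x₂, hx₂, h2⟩ := hT2 r x hx
      have := hmin x₁ hx₁
      have := hmax x₂ hx₂
      omega
  · push Not at hlong
    obtain ⟨y, hy⟩ := setOfLengths_nonempty hH.isAtomicMonoid b
    -- All lengths lie below `primaryExponent (a ^ D)`, so a single point serves as central part.
    refine isAAMP_of_contains_progression (y := y) (m := 0) hd (dvd_zero _)
      (fun x hx => hcong _ _ _ hy hx) ?_ ?_
    · intro i hi
      rwa [Nat.le_zero.1 hi, add_zero]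
    · intro x hx
      have := hlong x hx
      have := hlong y hy
      omega

end AAMP

end FactorizationTheory

theorem theorem5p5 (H : Type u) [CancelCommMonoid H]
    (hH : IsStronglyPrimary H) (hnhf : ¬ IsHalfFactorial H) :
    (∃ β : ℚ, 1 < β ∧
      ∀ L ∈ lengthSystem H, elasticity L ≠ 1 → ENNReal.ofReal (β : ℝ) ≤ elasticity L) ∧
    ((∀ (G : Type v) [AddCommGroup G] (G₀ : Set G),
        lengthSystem H ≠ lengthSystem (ZeroSumMonoid G₀)) ∧
      ¬ IsTransferKrull.{u, v} H) ∧
    (((⨆ c : H, ((sInf (setOfLengths c) : ℕ) : ℕ∞)) < ⊤ → IsLocallyTame H) ∧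
      ((∃ a : H, ¬ IsUnit a ∧ kthElasticity H (primaryExponent a) < ⊤) → IsLocallyTame H) ∧
      (IsLocallyTame H →
        (distanceSet H).Finite ∧
        ∃ M : ℕ, ∀ L ∈ lengthSystem H,
          IsAAMP (sInf (distanceSet H)) {0, ((sInf (distanceSet H) : ℕ) : ℤ)} M
            ((fun n : ℕ => (n : ℤ)) '' L))) := by
  refine ⟨exists_elasticity_gap hH hnhf,
    ⟨fun G _ G₀ => lengthSystem_ne_lengthSystem_zeroSumMonoid hH hnhf G₀,
      not_isTransferKrull hH hnhf⟩,
    isLocallyTame_of_min_bounded hH,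
    fun ⟨_, ha, h⟩ => isLocallyTame_of_kthElasticity hH ha h, fun hT => ⟨?_, ?_⟩⟩
  · obtain ⟨D, hD⟩ := hT.exists_distance_bound hH
    refine (Set.finite_Iic D).subset fun d hd => ?_
    obtain ⟨b, hb⟩ := mem_distanceSet.1 hd
    exact hD b d hb
  · exact hT.exists_isAAMP hH (distanceSet_nonempty hH hnhf)
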